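/- All Hilbert spaces are finite-dimensional. For a state $\sigma$ let $S(\sigma)=-\mathrm{Tr}[\sigma\log_2\sigma]$ be its von Neumann entropy, and for a bipartite state $\sigma_{XY}$ with marginals $\sigma_X,\sigma_Y$ let $I^{X:Y}(\sigma_{XY})=S(\sigma_X)+S(\sigma_Y)-S(\sigma_{XY})$ be the quantum mutual information. For a state $\rho_{RA}$ on $\mathcal H_R\otimes\mathcal H_A$ and an isometry $V:\mathcal H_A\to\mathcal H_B\otimes\mathcal H_E$ (that is, $V^\dagger V=1_A$) put $\varsigma_{RBE}=(1_R\otimes V)\rho_{RA}(1_R\otimes V^\dagger)$, and for $\varepsilon\in[0,\infty]$ define the $\varepsilon$-ineliminable information $$\Xi_A(\rho_{RA};\varepsilon)=\inf\left\{I^{R:B}(\varsigma_{RB})\;:\;I^{R:E}(\varsigma_{RE})\le\varepsilon,\ I^{R:E}(\varsigma_{RE})\le I^{R:B}(\varsigma_{RB})\right\},$$ where the infimum is over all finite-dimensional $\mathcal H_B,\mathcal H_E$ and all isometries $V:\mathcal H_A\to\mathcal H_B\otimes\mathcal H_E$ satisfying the two constraints. Write $\Xi_A(\rho_{RA})=\Xi_A(\rho_{RA};\infty)$.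 **Corollary (Monogamy relation).** Let $|\Psi_{RAB}\rangle\in\mathcal H_R\otimes\mathcal H_A\otimes\mathcal H_B$ be a unit vector, and let $\rho_{RA}=\mathrm{Tr}_B\,|\Psi\rangle\langle\Psi|$, $\rho_{RB}=\mathrm{Tr}_A\,|\Psi\rangle\langle\Psi|$ and $\rho_R=\mathrm{Tr}_{AB}\,|\Psi\rangle\langle\Psi|$. Then the infima defining $\Xi_A(\rho_{RA})$ and $\Xi_B(\rho_{RB})$ are taken over non-empty sets of real numbers that are bounded below, and $$\Xi_A(\rho_{RA})+\Xi_B(\rho_{RB})\le S(\rho_R).$$ -/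

import Mathlib

open scoped Matrix Kronecker

noncomputable section

namespace PQD

/-- Von Neumann entropy `S(σ) = -Tr[σ log₂ σ]`, in bits. The operator logarithm is taken in the
functional calculus of Hermitian matrices; since `Real.logb 2 0 = 0`, the convention
`0 log₂ 0 = 0` is in force. -/
def entropy {X : Type*} [Fintype X] [DecidableEq X] (σ : Matrix X X ℂ) : ℝ :=
  -(σ * cfc (Real.logb 2) σ).trace.re

/-- `Tr_Y` of an operator on `X ⊗ Y`. -/
def trRight {X Y : Type*} [Fintype Y] (σ : Matrix (X × Y) (X × Y) ℂ) : Matrix X X ℂ :=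
  Matrix.of fun x x' => ∑ y, σ (x, y) (x', y)

/-- `Tr_X` of an operator on `X ⊗ Y`. -/
def trLeft {X Y : Type*} [Fintype X] (σ : Matrix (X × Y) (X × Y) ℂ) : Matrix Y Y ℂ :=
  Matrix.of fun y y' => ∑ x, σ (x, y) (x, y')

/-- `Tr_Z` of an operator on `X ⊗ Y ⊗ Z`. -/
def trThird {X Y Z : Type*} [Fintype Z] (σ : Matrix (X × Y × Z) (X × Y × Z) ℂ) :
    Matrix (X × Y) (X × Y) ℂ :=
  Matrix.of fun p q => ∑ z, σ (p.1, p.2, z) (q.1, q.2, z)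

/-- `Tr_Y` of an operator on `X ⊗ Y ⊗ Z`. -/
def trSecond {X Y Z : Type*} [Fintype Y] (σ : Matrix (X × Y × Z) (X × Y × Z) ℂ) :
    Matrix (X × Z) (X × Z) ℂ :=
  Matrix.of fun p q => ∑ y, σ (p.1, y, p.2) (q.1, y, q.2)

/-- Quantum mutual information `I(X : Y) = S(X) + S(Y) - S(XY)`. -/
def mutualInfo {X Y : Type*} [Fintype X] [DecidableEq X] [Fintype Y] [DecidableEq Y]
    (σ : Matrix (X × Y) (X × Y) ℂ) : ℝ :=
  entropy (trRight σ) + entropy (trLeft σ) - entropy σ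

/-- The output state `ς_RBE = (1_R ⊗ V) ρ_RA (1_R ⊗ V)†` of a local operation `V : A → B ⊗ E`. -/
def output {R A B E : Type*} [Fintype R] [DecidableEq R] [Fintype A]
    (ρ : Matrix (R × A) (R × A) ℂ) (V : Matrix (B × E) A ℂ) :
    Matrix (R × B × E) (R × B × E) ℂ :=
  ((1 : Matrix R R ℂ) ⊗ₖ V) * ρ * ((1 : Matrix R R ℂ) ⊗ₖ V)ᴴ

/-- The set `𝒱_ε(ρ_RA)` of isometries `V : A → B ⊗ E`, for given output spaces `B` and `E`, with
`I(R : E) ≤ ε` and `I(R : E) ≤ I(R : B)`. The privacy parameter `ε` may be `⊤ = ∞`. -/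
def isometries {R A : Type*} [Fintype R] [DecidableEq R] [Fintype A] [DecidableEq A]
    (B E : Type*) [Fintype B] [DecidableEq B] [Fintype E] [DecidableEq E]
    (ρ : Matrix (R × A) (R × A) ℂ) (ε : EReal) : Set (Matrix (B × E) A ℂ) :=
  {V | Vᴴ * V = 1 ∧
    (mutualInfo (trSecond (output ρ V)) : EReal) ≤ ε ∧
    mutualInfo (trSecond (output ρ V)) ≤ mutualInfo (trThird (output ρ V))}

/-- The values `I(R : B)` reached by the isometries in `𝒱_ε(ρ_RA)`, over all finite-dimensional
output spaces `B` and `E`. -/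
def values {R A : Type*} [Fintype R] [DecidableEq R] [Fintype A] [DecidableEq A]
    (ρ : Matrix (R × A) (R × A) ℂ) (ε : EReal) : Set ℝ :=
  {t | ∃ (dB dE : ℕ), ∃ V ∈ isometries (Fin dB) (Fin dE) ρ ε,
    t = mutualInfo (trThird (output ρ V))}

/-- The `ε`-ineliminable information `Ξ_A(ρ_RA; ε)`. -/
def ineliminable {R A : Type*} [Fintype R] [DecidableEq R] [Fintype A] [DecidableEq A]
    (ρ : Matrix (R × A) (R × A) ℂ) (ε : EReal) : ℝ :=
  sInf (values ρ ε)

/-- The ineliminable information `Ξ_A(ρ_RA) = Ξ_A(ρ_RA; ∞)`. -/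
def Xi {R A : Type*} [Fintype R] [DecidableEq R] [Fintype A] [DecidableEq A]
    (ρ : Matrix (R × A) (R × A) ℂ) : ℝ :=
  ineliminable ρ ⊤

/-- The rank-one operator `|Ψ⟩⟨Ψ|`. -/
def ketbra {X : Type*} (Ψ : EuclideanSpace ℂ X) : Matrix X X ℂ :=
  Matrix.of fun x x' => Ψ x * star (Ψ x')

end PQD

end

/-! Sending `A` in equal coherent superposition to `B` or to `E`, with a vacuum state in the other
output, is an isometry symmetric under exchange of the outputs. Hence I(R:E) = I(R:B), so it is
admissible at ε = ∞. Tracing out one output leaves an even mixture of ρ_RA and ρ_R ⊗ |vac⟩⟨vac| in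
orthogonal sectors, whose mutual information is half that of ρ_RA. So Ξ_A ≤ I(R:A)/2
(`Xi_le_half_mutualInfo`), and likewise Ξ_B ≤ I(R:B)/2. For pure Ψ, I(R:A) + I(R:B) = 2 S(R)
(`mutualInfo_add_mutualInfo_ketbra`), which gives the bound. The infima are genuine because the
splitting isometry supplies an element and subadditivity (`mutualInfo_nonneg`) supplies the lower
bound 0. -/

open scoped Matrix Kronecker ComplexOrder

namespace PQD

/-! ### Spectral formulas for the entropy -/

section Entropy

variable {X Y : Type*} [Fintype X] [DecidableEq X] [Fintype Y] [DecidableEq Y]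

/-- The function `-x log₂ x`. -/
noncomputable def eta (x : ℝ) : ℝ := Real.negMulLog x / Real.log 2

lemma eta_zero : eta 0 = 0 := by simp [eta]

lemma eta_one : eta 1 = 0 := by simp [eta]

lemma eta_half_mul (x : ℝ) : eta ((1 / 2) * x) = (1 / 2) * eta x + (1 / 2) * x := by
  have h2 : Real.log 2 ≠ 0 := (Real.log_pos one_lt_two).ne'
  have h : Real.negMulLog (1 / 2) = (1 / 2) * Real.log 2 := by
    simp [Real.negMulLog]
  rw [eta, eta, Real.negMulLog_mul, h]
  field_simp
  ring

lemma exists_diagonalization {σ : Matrix X X ℂ} (h : σ.IsHermitian) :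
    ∃ U : Matrix X X ℂ, Uᴴ * U = 1 ∧ U * Uᴴ = 1 ∧
      σ = U * Matrix.diagonal (fun i => (h.eigenvalues i : ℂ)) * Uᴴ := by
  refine ⟨h.eigenvectorUnitary, ?_, ?_, ?_⟩
  · exact Unitary.coe_star_mul_self h.eigenvectorUnitary
  · exact Unitary.coe_mul_star_self h.eigenvectorUnitary
  · conv_lhs => rw [h.spectral_theorem, Unitary.conjStarAlgAut_apply]
    rfl

lemma entropy_eq_sum_eigenvalues {σ : Matrix X X ℂ} (h : σ.IsHermitian) :
    entropy σ = ∑ i, eta (h.eigenvalues i) := by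
  have key : (σ * cfc (Real.logb 2) σ).trace =
      ∑ i, ((h.eigenvalues i * Real.logb 2 (h.eigenvalues i) : ℝ) : ℂ) := by
    rw [h.cfc_eq, Matrix.IsHermitian.cfc]
    nth_rewrite 1 [h.spectral_theorem]
    rw [← map_mul, Matrix.diagonal_mul_diagonal, Unitary.conjStarAlgAut_apply,
      Matrix.trace_mul_comm, ← mul_assoc, Unitary.coe_star_mul_self, one_mul,
      Matrix.trace_diagonal]
    simp
  rw [entropy, key, ← Complex.ofReal_sum, Complex.ofReal_re, ← Finset.sum_neg_distrib]
  refine Finset.sum_congr rfl fun i _ => ?_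
  simp [eta, Real.negMulLog, Real.logb]
  ring

/-- Depending on the characteristic polynomial alone, entropies can be compared across different
index types without matching eigenvalues. -/
lemma entropy_eq_sum_roots {σ : Matrix X X ℂ} (h : σ.IsHermitian) :
    entropy σ = (σ.charpoly.roots.map fun z => eta z.re).sum := by
  rw [entropy_eq_sum_eigenvalues h, h.roots_charpoly_eq_eigenvalues]
  simp

lemma entropy_congr_charpoly {σ : Matrix X X ℂ} {τ : Matrix Y Y ℂ} (hσ : σ.IsHermitian)
    (hτ : τ.IsHermitian) (h : σ.charpoly = τ.charpoly) : entropy σ = entropy τ := by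
  rw [entropy_eq_sum_roots hσ, entropy_eq_sum_roots hτ, h]

lemma entropy_transpose {σ : Matrix X X ℂ} (h : σ.IsHermitian) : entropy σᵀ = entropy σ :=
  entropy_congr_charpoly h.transpose h σ.charpoly_transpose

lemma entropy_reindex {σ : Matrix X X ℂ} (h : σ.IsHermitian) (e : X ≃ Y) :
    entropy (Matrix.reindex e e σ) = entropy σ :=
  entropy_congr_charpoly (by simpa using h.submatrix e.symm) h (Matrix.charpoly_reindex e σ)

lemma entropy_unitary_conj {σ : Matrix X X ℂ} (h : σ.IsHermitian) {U : Matrix X X ℂ}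
    (hU : U * Uᴴ = 1) : entropy (Uᴴ * σ * U) = entropy σ := by
  refine entropy_congr_charpoly (Matrix.isHermitian_conjTranspose_mul_mul U h) h ?_
  rw [Matrix.charpoly_mul_comm, ← mul_assoc, hU, one_mul]

lemma entropy_diagonal (d : X → ℝ) :
    entropy (Matrix.diagonal fun i => (d i : ℂ)) = ∑ i, eta (d i) := by
  have h : (Matrix.diagonal fun i => (d i : ℂ)).IsHermitian :=
    Matrix.isHermitian_diagonal_of_self_adjoint _ (by ext i; simp)
  rw [entropy_eq_sum_roots h, Matrix.charpoly_diagonal, Polynomial.roots_prod]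
  · simp
  · simp [Finset.prod_ne_zero_iff, Polynomial.X_sub_C_ne_zero]

/-- The two reductions of a bipartite pure state have the same entropy. -/
lemma entropy_mul_conjTranspose_comm (M : Matrix X Y ℂ) :
    entropy (M * Mᴴ) = entropy (Mᴴ * M) := by
  -- The two characteristic polynomials agree up to powers of `X`; the extra roots are zeros, and
  -- `eta 0 = 0`.
  have h := congrArg (fun p : Polynomial ℂ => (p.roots.map fun z => eta z.re).sum)
    (Matrix.charpoly_mul_comm' M Mᴴ)
  rw [entropy_eq_sum_roots (Matrix.isHermitian_mul_conjTranspose_self M),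
    entropy_eq_sum_roots (Matrix.isHermitian_conjTranspose_mul_self M)]
  have hX : ∀ k : ℕ, (Polynomial.X ^ k : Polynomial ℂ) ≠ 0 := fun k =>
    pow_ne_zero _ Polynomial.X_ne_zero
  simp only [Polynomial.roots_mul (mul_ne_zero (hX _) (M * Mᴴ).charpoly_monic.ne_zero),
    Polynomial.roots_mul (mul_ne_zero (hX _) (Mᴴ * M).charpoly_monic.ne_zero)] at h
  simpa [Multiset.map_nsmul, Multiset.sum_nsmul, eta_zero] using h

lemma entropy_fromBlocks {σ : Matrix X X ℂ} {τ : Matrix Y Y ℂ} (hσ : σ.IsHermitian)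
    (hτ : τ.IsHermitian) :
    entropy (Matrix.fromBlocks σ 0 0 τ) = entropy σ + entropy τ := by
  rw [entropy_eq_sum_roots (hσ.fromBlocks (by simp) hτ), entropy_eq_sum_roots hσ,
    entropy_eq_sum_roots hτ, Matrix.charpoly_fromBlocks_zero₁₂,
    Polynomial.roots_mul (mul_ne_zero σ.charpoly_monic.ne_zero τ.charpoly_monic.ne_zero)]
  simp

lemma entropy_half_smul {σ : Matrix X X ℂ} (h : σ.IsHermitian) :
    entropy ((1 / 2 : ℂ) • σ) = (1 / 2) * entropy σ + (1 / 2) * σ.trace.re := by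
  obtain ⟨U, hU, hU', hσ⟩ := exists_diagonalization h
  have e : (1 / 2 : ℂ) • σ = Uᴴᴴ *
      Matrix.diagonal (fun i => (((1 / 2) * h.eigenvalues i : ℝ) : ℂ)) * Uᴴ := by
    conv_lhs => rw [hσ]
    rw [Matrix.conjTranspose_conjTranspose, ← Matrix.smul_mul, ← Matrix.mul_smul,
      ← Matrix.diagonal_smul]
    congr 3
    ext i
    simp
  rw [e, entropy_unitary_conj _ (by simpa using hU), entropy_diagonal,
    entropy_eq_sum_eigenvalues h, h.trace_eq_sum_eigenvalues]
  · simp only [eta_half_mul, Finset.sum_add_distrib, Finset.mul_sum]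
    simp [Finset.mul_sum]
  · exact Matrix.isHermitian_diagonal_of_self_adjoint _ (by ext i; simp)

/-- The entropy does not decrease when a state is replaced by its diagonal. -/
lemma entropy_le_sum_diag {σ : Matrix X X ℂ} (h : σ.PosSemidef) :
    entropy σ ≤ ∑ j, eta (σ j j).re := by
  obtain ⟨U, hU, hU', hσ⟩ := exists_diagonalization h.1
  set l := h.1.eigenvalues with hl
  -- The weights |U_ji|² are doubly stochastic: row sums allow Jensen, column sums recover the
  -- entropy.
  have hd : ∀ j, (σ j j).re = ∑ i, Complex.normSq (U j i) • l i := fun j => by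
    rw [hσ, Matrix.mul_apply, Complex.re_sum]
    refine Finset.sum_congr rfl fun i _ => ?_
    rw [Matrix.mul_diagonal, Matrix.conjTranspose_apply, mul_right_comm]
    simp [Complex.mul_conj, -Complex.mul_re, ← Complex.ofReal_mul]
  have hrow : ∀ j, ∑ i, Complex.normSq (U j i) = 1 := fun j => by
    have := congrFun (congrFun hU' j) j
    simp only [Matrix.mul_apply, Matrix.conjTranspose_apply, Matrix.one_apply_eq,
      Complex.star_def, Complex.mul_conj] at this
    exact_mod_cast this
  have hcol : ∀ i, ∑ j, Complex.normSq (U j i) = 1 := fun i => by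
    have := congrFun (congrFun hU i) i
    simp only [Matrix.mul_apply, Matrix.conjTranspose_apply, Matrix.one_apply_eq,
      Complex.star_def, mul_comm (starRingEnd ℂ _), Complex.mul_conj] at this
    exact_mod_cast this
  have hJ : ∀ j, ∑ i, Complex.normSq (U j i) * eta (l i) ≤ eta (σ j j).re := fun j => by
    have := Real.concaveOn_negMulLog.le_map_sum (t := Finset.univ)
      (w := fun i => Complex.normSq (U j i)) (p := l)
      (fun i _ => Complex.normSq_nonneg _) (hrow j) (fun i _ => h.eigenvalues_nonneg i)
    rw [hd, eta]
    simp only [eta, ← mul_div_assoc, ← Finset.sum_div]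
    exact div_le_div_of_nonneg_right this (Real.log_pos one_lt_two).le
  calc entropy σ = ∑ i, eta (l i) := entropy_eq_sum_eigenvalues h.1
    _ = ∑ j, ∑ i, Complex.normSq (U j i) * eta (l i) := by
      rw [Finset.sum_comm]
      simp [← Finset.sum_mul, hcol]
    _ ≤ _ := Finset.sum_le_sum fun j _ => hJ j

end Entropy

/-- Subadditivity of the Shannon entropy. -/
lemma sum_eta_prod_le {X Y : Type*} [Fintype X] [Fintype Y] {r : X × Y → ℝ}
    (hr : ∀ z, 0 ≤ r z) (h1 : ∑ z, r z = 1) :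
    ∑ z, eta (r z) ≤ ∑ x, eta (∑ y, r (x, y)) + ∑ y, eta (∑ x, r (x, y)) := by
  set p : X → ℝ := fun x => ∑ y, r (x, y) with hp
  set q : Y → ℝ := fun y => ∑ x, r (x, y) with hq
  have hp1 : ∑ x, p x = 1 := by rw [← h1, Fintype.sum_prod_type]
  have hq1 : ∑ y, q y = 1 := by rw [← h1, Fintype.sum_prod_type_right]
  -- This is log t ≤ t - 1 at t = pq/r, multiplied by r; the right-hand sides sum to 1 - 1 = 0.
  have pt : ∀ z : X × Y, Real.negMulLog (r z) + r z * Real.log (p z.1) +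
      r z * Real.log (q z.2) ≤ p z.1 * q z.2 - r z := by
    rintro ⟨x, y⟩
    have hpx : r (x, y) ≤ p x :=
      Finset.single_le_sum (f := fun y => r (x, y)) (fun y _ => hr _) (Finset.mem_univ y)
    have hqy : r (x, y) ≤ q y :=
      Finset.single_le_sum (f := fun x => r (x, y)) (fun x _ => hr _) (Finset.mem_univ x)
    rcases (hr (x, y)).eq_or_lt with h0 | h0
    · simpa [← h0] using mul_nonneg ((hr _).trans hpx) ((hr _).trans hqy)
    · have hp0 := h0.trans_le hpx
      have hq0 := h0.trans_le hqy
      have := Real.log_le_sub_one_of_pos (div_pos (mul_pos hp0 hq0) h0)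
      rw [Real.log_div (mul_pos hp0 hq0).ne' h0.ne', Real.log_mul hp0.ne' hq0.ne'] at this
      have := mul_le_mul_of_nonneg_left this h0.le
      rw [mul_sub _ (_ / _), mul_div_cancel₀ _ h0.ne'] at this
      simp only [Real.negMulLog]
      linarith
  have hs := Finset.sum_le_sum fun z (_ : z ∈ Finset.univ) => pt z
  have e1 : ∑ z : X × Y, r z * Real.log (p z.1) = -∑ x, Real.negMulLog (p x) := by
    rw [Fintype.sum_prod_type, ← Finset.sum_neg_distrib]
    simp [← Finset.sum_mul, Real.negMulLog, hp]
  have e2 : ∑ z : X × Y, r z * Real.log (q z.2) = -∑ y, Real.negMulLog (q y) := by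
    rw [Fintype.sum_prod_type_right, ← Finset.sum_neg_distrib]
    simp [← Finset.sum_mul, Real.negMulLog, hq]
  have e3 : ∑ z : X × Y, p z.1 * q z.2 = 1 := by
    rw [Fintype.sum_prod_type]
    simp [← Finset.mul_sum, hp1, hq1]
  rw [Finset.sum_add_distrib, Finset.sum_add_distrib, Finset.sum_sub_distrib, e1, e2, e3,
    h1] at hs
  simp only [eta, ← Finset.sum_div, ← add_div]
  refine div_le_div_of_nonneg_right ?_ (Real.log_pos one_lt_two).le
  linarith

/-! ### Partial traces under local unitaries -/

section PartialTrace

variable {X Y : Type*} [Fintype X] [Fintype Y]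

lemma trace_trRight_mul [DecidableEq Y] (σ : Matrix (X × Y) (X × Y) ℂ) (M : Matrix X X ℂ) :
    (trRight σ * M).trace = (σ * (M ⊗ₖ (1 : Matrix Y Y ℂ))).trace := by
  simp only [Matrix.trace, Matrix.diag_apply, Matrix.mul_apply, trRight, Matrix.of_apply,
    Matrix.kroneckerMap_apply, Fintype.sum_prod_type, Matrix.one_apply, mul_ite, mul_one,
    mul_zero, Finset.sum_ite_eq', Finset.mem_univ, if_true, Finset.sum_mul]
  exact Finset.sum_congr rfl fun x _ => Finset.sum_comm

lemma trace_trLeft_mul [DecidableEq X] (σ : Matrix (X × Y) (X × Y) ℂ) (M : Matrix Y Y ℂ) :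
    (trLeft σ * M).trace = (σ * ((1 : Matrix X X ℂ) ⊗ₖ M)).trace := by
  simp only [Matrix.trace, Matrix.diag_apply, Matrix.mul_apply, trLeft, Matrix.of_apply,
    Matrix.kroneckerMap_apply, Fintype.sum_prod_type_right, Matrix.one_apply, ite_mul, mul_ite,
    one_mul, zero_mul, mul_zero, Finset.sum_ite_eq', Finset.mem_univ, if_true,
    Finset.sum_mul]
  exact Finset.sum_congr rfl fun x _ => Finset.sum_comm

/-- By duality: partial trace is adjoint to M ↦ M ⊗ 1, and b cancels against its adjoint. -/
lemma trRight_kronecker_conj [DecidableEq X] [DecidableEq Y]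
    (σ : Matrix (X × Y) (X × Y) ℂ) (a : Matrix X X ℂ)
    {b : Matrix Y Y ℂ} (hb : b * bᴴ = 1) :
    trRight ((a ⊗ₖ b)ᴴ * σ * (a ⊗ₖ b)) = aᴴ * trRight σ * a := by
  rw [Matrix.ext_iff_trace_mul_right]
  intro M
  rw [trace_trRight_mul, mul_assoc, mul_assoc, Matrix.trace_mul_comm, mul_assoc, mul_assoc aᴴ,
    mul_assoc aᴴ, Matrix.trace_mul_comm aᴴ, mul_assoc, mul_assoc, mul_assoc, trace_trRight_mul,
    Matrix.conjTranspose_kronecker, ← Matrix.mul_kronecker_mul, ← Matrix.mul_kronecker_mul,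
    one_mul, hb]

lemma trLeft_kronecker_conj [DecidableEq X] [DecidableEq Y]
    (σ : Matrix (X × Y) (X × Y) ℂ) {a : Matrix X X ℂ}
    (ha : a * aᴴ = 1) (b : Matrix Y Y ℂ) :
    trLeft ((a ⊗ₖ b)ᴴ * σ * (a ⊗ₖ b)) = bᴴ * trLeft σ * b := by
  rw [Matrix.ext_iff_trace_mul_right]
  intro M
  rw [trace_trLeft_mul, mul_assoc, mul_assoc, Matrix.trace_mul_comm, mul_assoc, mul_assoc bᴴ,
    mul_assoc bᴴ, Matrix.trace_mul_comm bᴴ, mul_assoc, mul_assoc, mul_assoc, trace_trLeft_mul,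
    Matrix.conjTranspose_kronecker, ← Matrix.mul_kronecker_mul, ← Matrix.mul_kronecker_mul,
    one_mul, ha]

lemma trace_trRight (σ : Matrix (X × Y) (X × Y) ℂ) : (trRight σ).trace = σ.trace := by
  simp [Matrix.trace, trRight, Fintype.sum_prod_type]

lemma trace_trLeft (σ : Matrix (X × Y) (X × Y) ℂ) : (trLeft σ).trace = σ.trace := by
  simp [Matrix.trace, trLeft, Fintype.sum_prod_type_right]

end PartialTrace

section PosSemidef

variable {X Y Z : Type*}

lemma posSemidef_sum_submatrix {W ι : Type*} [Fintype ι] {σ : Matrix X X ℂ} (h : σ.PosSemidef)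
    (f : ι → W → X) : (∑ i, σ.submatrix (f i) (f i)).PosSemidef :=
  Matrix.posSemidef_sum _ fun i _ => h.submatrix (f i)

lemma posSemidef_trRight [Fintype Y] {σ : Matrix (X × Y) (X × Y) ℂ} (h : σ.PosSemidef) :
    (trRight σ).PosSemidef := by
  convert posSemidef_sum_submatrix h fun (y : Y) (x : X) => (x, y)
  ext
  simp [trRight, Matrix.sum_apply]

lemma posSemidef_trLeft [Fintype X] {σ : Matrix (X × Y) (X × Y) ℂ} (h : σ.PosSemidef) :
    (trLeft σ).PosSemidef := by
  convert posSemidef_sum_submatrix h fun (x : X) (y : Y) => (x, y)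
  ext
  simp [trLeft, Matrix.sum_apply]

lemma posSemidef_trThird [Fintype Z] {σ : Matrix (X × Y × Z) (X × Y × Z) ℂ}
    (h : σ.PosSemidef) : (trThird σ).PosSemidef := by
  convert posSemidef_sum_submatrix h fun (z : Z) (p : X × Y) => (p.1, p.2, z)
  ext
  simp [trThird, Matrix.sum_apply]

lemma posSemidef_trSecond [Fintype Y] {σ : Matrix (X × Y × Z) (X × Y × Z) ℂ}
    (h : σ.PosSemidef) : (trSecond σ).PosSemidef := by
  convert posSemidef_sum_submatrix h fun (y : Y) (p : X × Z) => (p.1, y, p.2)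
  ext
  simp [trSecond, Matrix.sum_apply]

lemma posSemidef_ketbra [Finite X] (Ψ : EuclideanSpace ℂ X) : (ketbra Ψ).PosSemidef :=
  Matrix.posSemidef_vecMulVec_self_star (n := X) (R := ℂ) Ψ

end PosSemidef

/-! ### Nonnegativity of mutual information -/

section MutualInfo

variable {X Y : Type*} [Fintype X] [DecidableEq X] [Fintype Y] [DecidableEq Y]

/-- Subadditivity of the von Neumann entropy. -/
lemma mutualInfo_nonneg {σ : Matrix (X × Y) (X × Y) ℂ} (h : σ.PosSemidef)
    (h1 : σ.trace = 1) : 0 ≤ mutualInfo σ := by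
  have hX := (posSemidef_trRight h).1
  have hY := (posSemidef_trLeft h).1
  obtain ⟨a, ha, ha', eX⟩ := exists_diagonalization hX
  obtain ⟨b, hb, hb', eY⟩ := exists_diagonalization hY
  have hab : (a ⊗ₖ b) * (a ⊗ₖ b)ᴴ = 1 := by
    rw [Matrix.conjTranspose_kronecker, ← Matrix.mul_kronecker_mul, ha', hb',
      Matrix.one_kronecker_one]
  -- In the product of the marginals' eigenbases, the diagonal of `τ` is a joint distribution whose
  -- marginals are the two spectra, so the classical inequality applies.
  set τ := (a ⊗ₖ b)ᴴ * σ * (a ⊗ₖ b) with hτ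
  have hτp : τ.PosSemidef := h.conjTranspose_mul_mul_same _
  have eX' : trRight τ = Matrix.diagonal fun i => (hX.eigenvalues i : ℂ) := by
    rw [hτ, trRight_kronecker_conj σ a hb']
    conv_lhs => rw [eX]
    rw [← mul_assoc, ← mul_assoc, ha, one_mul, mul_assoc, ha, mul_one]
  have eY' : trLeft τ = Matrix.diagonal fun i => (hY.eigenvalues i : ℂ) := by
    rw [hτ, trLeft_kronecker_conj σ ha' b]
    conv_lhs => rw [eY]
    rw [← mul_assoc, ← mul_assoc, hb, one_mul, mul_assoc, hb, mul_one]
  have dX : ∀ x, ∑ y, (τ (x, y) (x, y)).re = hX.eigenvalues x := fun x => by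
    have := congrArg Complex.re (congrFun (congrFun eX' x) x)
    simpa [trRight] using this
  have dY : ∀ y, ∑ x, (τ (x, y) (x, y)).re = hY.eigenvalues y := fun y => by
    have := congrArg Complex.re (congrFun (congrFun eY' y) y)
    simpa [trLeft] using this
  have htr : ∑ z, (τ z z).re = 1 := by
    have : τ.trace = 1 := by
      rw [hτ, Matrix.trace_mul_comm, ← mul_assoc, hab, one_mul, h1]
    simpa [Matrix.trace] using congrArg Complex.re this
  have := sum_eta_prod_le (r := fun z => (τ z z).re)
    (fun z => (Complex.nonneg_iff.1 hτp.diag_nonneg).1) htr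
  simp only [dX, dY] at this
  rw [← entropy_eq_sum_eigenvalues, ← entropy_eq_sum_eigenvalues] at this
  have h2 := entropy_le_sum_diag hτp
  rw [hτ, entropy_unitary_conj h.1 hab] at h2
  rw [mutualInfo]
  linarith

end MutualInfo

/-! ### Complementary marginals of a pure state -/

section Purification

variable {R A B : Type*} [Fintype A] [Fintype B]

lemma trRight_trThird_ketbra (Ψ : EuclideanSpace ℂ (R × A × B)) :
    trRight (trThird (ketbra Ψ)) = trRight (ketbra Ψ) := by
  ext
  simp [trRight, trThird, Fintype.sum_prod_type]

lemma trRight_trSecond_ketbra (Ψ : EuclideanSpace ℂ (R × A × B)) :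
    trRight (trSecond (ketbra Ψ)) = trRight (ketbra Ψ) := by
  ext
  simp [trRight, trSecond, Fintype.sum_prod_type_right]

variable [Fintype R] [DecidableEq R] [DecidableEq A] [DecidableEq B]

lemma entropy_trLeft_trThird_ketbra (Ψ : EuclideanSpace ℂ (R × A × B)) :
    entropy (trLeft (trThird (ketbra Ψ))) = entropy (trSecond (ketbra Ψ)) := by
  -- Schmidt argument: reshaped across the cut A | RB, Ψ has marginals M Mᴴ and, up to
  -- transposition, Mᴴ M.
  set M : Matrix A (R × B) ℂ := Matrix.of fun a p => Ψ (p.1, a, p.2) with hM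
  have h1 : trLeft (trThird (ketbra Ψ)) = M * Mᴴ := by
    ext
    simp [hM, trLeft, trThird, ketbra, Matrix.mul_apply, Fintype.sum_prod_type]
  have h2 : trSecond (ketbra Ψ) = (Mᴴ * M)ᵀ := by
    ext
    simp [hM, trSecond, ketbra, Matrix.mul_apply, mul_comm]
  rw [h1, h2, entropy_transpose (Matrix.isHermitian_conjTranspose_mul_self M),
    entropy_mul_conjTranspose_comm]

lemma entropy_trLeft_trSecond_ketbra (Ψ : EuclideanSpace ℂ (R × A × B)) :
    entropy (trLeft (trSecond (ketbra Ψ))) = entropy (trThird (ketbra Ψ)) := by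
  set M : Matrix B (R × A) ℂ := Matrix.of fun b p => Ψ (p.1, p.2, b) with hM
  have h1 : trLeft (trSecond (ketbra Ψ)) = M * Mᴴ := by
    ext
    simp [hM, trLeft, trSecond, ketbra, Matrix.mul_apply, Fintype.sum_prod_type]
  have h2 : trThird (ketbra Ψ) = (Mᴴ * M)ᵀ := by
    ext
    simp [hM, trThird, ketbra, Matrix.mul_apply, mul_comm]
  rw [h1, h2, entropy_transpose (Matrix.isHermitian_conjTranspose_mul_self M),
    entropy_mul_conjTranspose_comm]

lemma mutualInfo_add_mutualInfo_ketbra (Ψ : EuclideanSpace ℂ (R × A × B)) :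
    mutualInfo (trThird (ketbra Ψ)) + mutualInfo (trSecond (ketbra Ψ)) =
      2 * entropy (trRight (ketbra Ψ)) := by
  rw [mutualInfo, mutualInfo, trRight_trThird_ketbra, trRight_trSecond_ketbra,
    entropy_trLeft_trThird_ketbra, entropy_trLeft_trSecond_ketbra]
  ring

lemma trace_ketbra {X : Type*} [Fintype X] (Ψ : EuclideanSpace ℂ X) (h : ‖Ψ‖ = 1) :
    (ketbra Ψ).trace = 1 := by
  have h2 : ∑ x, ‖Ψ x‖ ^ 2 = 1 := by rw [← EuclideanSpace.norm_sq_eq, h, one_pow]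
  have : ∀ x, Ψ x * star (Ψ x) = ((‖Ψ x‖ ^ 2 : ℝ) : ℂ) := fun x => by
    simp [Complex.mul_conj, Complex.normSq_eq_norm_sq]
  simp only [Matrix.trace, Matrix.diag_apply, ketbra, Matrix.of_apply, this]
  exact_mod_cast h2

end Purification

/-! ### The vacuum-splitting isometry -/

section Splitting

variable {R A W : Type*} [DecidableEq A]

/-- Amplitudes of the coherent superposition of sending `A` to the left or to the right output,
the other output being left in the vacuum state `Sum.inr ()`. -/
def splitAmp : A ⊕ Unit → A ⊕ Unit → A → ℂ
  | .inl b, .inr _, a => if b = a then 1 else 0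
  | .inr _, .inl b, a => if b = a then 1 else 0
  | _, _, _ => 0

/-- The isometry `|a⟩ ↦ (|a⟩|vac⟩ + |vac⟩|a⟩) / √2`. -/
noncomputable def splitIsometry (e : A ⊕ Unit ≃ W) : Matrix (W × W) A ℂ :=
  Matrix.of fun p a => ((√2)⁻¹ : ℝ) * splitAmp (e.symm p.1) (e.symm p.2) a

lemma inv_sqrt_two_mul_self : (((√2)⁻¹ : ℝ) : ℂ) * (((√2)⁻¹ : ℝ) : ℂ) = 1 / 2 := by
  rw [← Complex.ofReal_mul, ← mul_inv, Real.mul_self_sqrt zero_le_two]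
  norm_num

lemma splitAmp_comm (x y : A ⊕ Unit) (a : A) : splitAmp x y a = splitAmp y x a := by
  rcases x with x | x <;> rcases y with y | y <;> rfl

lemma star_splitAmp (x y : A ⊕ Unit) (a : A) :
    (starRingEnd ℂ) (splitAmp x y a) = splitAmp x y a := by
  rcases x with x | x <;> rcases y with y | y <;> simp [splitAmp, apply_ite (starRingEnd ℂ)]

variable [Fintype R] [DecidableEq R] [Fintype A] [Fintype W]

lemma splitIsometry_isometry (e : A ⊕ Unit ≃ W) :
    (splitIsometry e)ᴴ * splitIsometry e = 1 := by
  ext a a'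
  have : ((splitIsometry e)ᴴ * splitIsometry e) a a' =
      ∑ x, ∑ y, (1 / 2 : ℂ) * (splitAmp x y a * splitAmp x y a') := by
    rw [Matrix.mul_apply, Fintype.sum_prod_type, ← e.sum_comp]
    refine Finset.sum_congr rfl fun x _ => ?_
    rw [← e.sum_comp]
    refine Finset.sum_congr rfl fun y _ => ?_
    rw [← inv_sqrt_two_mul_self]
    simp only [splitIsometry, Matrix.conjTranspose_apply, Matrix.of_apply, star_mul',
      Complex.star_def, Complex.conj_ofReal, star_splitAmp, Equiv.symm_apply_apply]
    ring
  rw [this]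
  by_cases h : a = a'
  · subst h
    simp [splitAmp, ← Finset.mul_sum]
    norm_num
  · simp [splitAmp, h, Ne.symm h]

lemma output_apply {R A B E : Type*} [Fintype R] [DecidableEq R] [Fintype A]
    (ρ : Matrix (R × A) (R × A) ℂ) (V : Matrix (B × E) A ℂ) (p q : R × B × E) :
    output ρ V p q = ∑ a, ∑ a', V p.2 a * ρ (p.1, a) (q.1, a') * star (V q.2 a') := by
  have left : ∀ z, (((1 : Matrix R R ℂ) ⊗ₖ V) * ρ) p z = ∑ a, V p.2 a * ρ (p.1, a) z := by
    simp [Matrix.mul_apply, Matrix.kroneckerMap_apply, Fintype.sum_prod_type, Matrix.one_apply]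
  rw [output, Matrix.mul_apply, Fintype.sum_prod_type_right, Finset.sum_comm]
  simp only [left, Matrix.conjTranspose_apply, Matrix.kroneckerMap_apply, Matrix.one_apply,
    apply_ite star, star_zero, ite_mul, one_mul, zero_mul, mul_ite, mul_zero,
    Finset.sum_mul]
  rw [Finset.sum_comm]
  simp only [Finset.sum_ite_eq, Finset.mem_univ, if_true]
  exact Finset.sum_comm

lemma trSecond_output_splitIsometry (ρ : Matrix (R × A) (R × A) ℂ) (e : A ⊕ Unit ≃ W) :
    trSecond (output ρ (splitIsometry e)) = trThird (output ρ (splitIsometry e)) := by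
  ext p q
  simp only [trSecond, trThird, Matrix.of_apply, output_apply, splitIsometry]
  exact Finset.sum_congr rfl fun w _ => Finset.sum_congr rfl fun a _ =>
    Finset.sum_congr rfl fun a' _ => by
      rw [splitAmp_comm, splitAmp_comm (e.symm w) (e.symm q.2)]

/-- The index equivalence exhibiting the block decomposition of the outputs. -/
def splitEquiv (R : Type*) (e : A ⊕ Unit ≃ W) : (R × A) ⊕ R ≃ R × W :=
  ((Equiv.sumCongr (Equiv.refl _) (Equiv.prodPUnit R).symm).trans
    (Equiv.prodSumDistrib R A Unit).symm).trans (Equiv.prodCongr (Equiv.refl R) e)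

/-- The traced-out output is in the vacuum exactly when the kept one is not, so it records the
branch and kills the off-diagonal blocks. -/
lemma trThird_output_splitIsometry (ρ : Matrix (R × A) (R × A) ℂ) (e : A ⊕ Unit ≃ W) :
    trThird (output ρ (splitIsometry e)) =
      Matrix.reindex (splitEquiv R e) (splitEquiv R e)
        (Matrix.fromBlocks ((1 / 2 : ℂ) • ρ) 0 0 ((1 / 2 : ℂ) • trRight ρ)) := by
  rw [← Equiv.symm_apply_eq]
  have key : ∀ r x r' x', trThird (output ρ (splitIsometry e)) (r, e x) (r', e x') =
      ∑ y, ∑ a, ∑ a', (1 / 2 : ℂ) *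
        (splitAmp x y a * ρ (r, a) (r', a') * splitAmp x' y a') := by
    intro r x r' x'
    simp only [trThird, Matrix.of_apply, output_apply]
    rw [← e.sum_comp]
    refine Finset.sum_congr rfl fun y _ => Finset.sum_congr rfl fun a _ =>
      Finset.sum_congr rfl fun a' _ => ?_
    rw [← inv_sqrt_two_mul_self]
    simp only [splitIsometry, Matrix.of_apply, star_mul',
      Complex.star_def, Complex.conj_ofReal, star_splitAmp, Equiv.symm_apply_apply]
    ring
  ext (⟨r, a⟩ | r) (⟨r', a'⟩ | r')
  · refine (key r (.inl a) r' (.inl a')).trans ?_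
    simp [splitAmp]
  · refine (key r (.inl a) r' (.inr ())).trans ?_
    simp [splitAmp]
  · refine (key r (.inr ()) r' (.inl a')).trans ?_
    simp [splitAmp]
  · refine (key r (.inr ()) r' (.inr ())).trans ?_
    simp [splitAmp, trRight, Finset.mul_sum]

/-- Here S(B) = S(A)/2 + 1 and S(RB) = S(RA)/2 + S(R)/2 + 1, while S(R) is unchanged; the mixing
bits cancel. -/
lemma mutualInfo_trThird_output_splitIsometry [DecidableEq W] {ρ : Matrix (R × A) (R × A) ℂ}
    (h : ρ.PosSemidef) (h1 : ρ.trace = 1) (e : A ⊕ Unit ≃ W) :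
    mutualInfo (trThird (output ρ (splitIsometry e))) = (1 / 2) * mutualInfo ρ := by
  rw [trThird_output_splitIsometry]
  set F := Matrix.fromBlocks ((1 / 2 : ℂ) • ρ) 0 0 ((1 / 2 : ℂ) • trRight ρ) with hF
  have half : IsSelfAdjoint (1 / 2 : ℂ) := by simp [IsSelfAdjoint]
  have hR := (posSemidef_trRight h).1
  have hA := (posSemidef_trLeft h).1
  have eR : trRight (Matrix.reindex (splitEquiv R e) (splitEquiv R e) F) = trRight ρ := by
    ext r r'
    simp only [trRight, Matrix.of_apply]
    rw [← e.sum_comp, Fintype.sum_sum_type]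
    simp [splitEquiv, hF, trRight, ← Finset.mul_sum]
    ring
  have eA : trLeft (Matrix.reindex (splitEquiv R e) (splitEquiv R e) F) =
      Matrix.reindex e e (Matrix.fromBlocks ((1 / 2 : ℂ) • trLeft ρ) 0 0
        ((1 / 2 : ℂ) • (1 : Matrix Unit Unit ℂ))) := by
    rw [← Equiv.symm_apply_eq]
    ext (a | u) (a' | u')
    · simp [splitEquiv, hF, trLeft, Finset.mul_sum]
    · simp [splitEquiv, hF, trLeft]
    · simp [splitEquiv, hF, trLeft]
    · have := h1
      rw [← trace_trRight] at this
      simpa [splitEquiv, hF, trLeft, ← Finset.mul_sum, Matrix.trace] using this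
  have e1 : entropy (1 : Matrix Unit Unit ℂ) = 0 := by
    simpa [eta_one] using entropy_diagonal (fun _ : Unit => (1 : ℝ))
  have hAh : ((1 / 2 : ℂ) • trLeft ρ).IsHermitian := hA.smul half
  have h1h : ((1 / 2 : ℂ) • (1 : Matrix Unit Unit ℂ)).IsHermitian :=
    Matrix.isHermitian_one.smul half
  have hF' : F.IsHermitian := (h.1.smul half).fromBlocks (by simp) (hR.smul half)
  rw [mutualInfo, eR, eA, entropy_reindex hF', entropy_reindex (hAh.fromBlocks (by simp) h1h),
    entropy_fromBlocks hAh h1h, entropy_fromBlocks (h.1.smul half) (hR.smul half),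
    entropy_half_smul h.1, entropy_half_smul hR, entropy_half_smul hA,
    entropy_half_smul Matrix.isHermitian_one, e1, trace_trRight, trace_trLeft, h1, mutualInfo]
  simp
  ring

end Splitting

/-! ### Bounds on the ineliminable information -/

section Ineliminable

lemma posSemidef_output {R A B E : Type*} [Fintype R] [DecidableEq R]
    [Fintype A] [Fintype B] [Fintype E] {ρ : Matrix (R × A) (R × A) ℂ}
    (h : ρ.PosSemidef) (V : Matrix (B × E) A ℂ) : (output ρ V).PosSemidef :=
  h.mul_mul_conjTranspose_same _

variable {R A : Type*} [Fintype R] [DecidableEq R] [Fintype A] [DecidableEq A]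

lemma half_mutualInfo_mem_values {ρ : Matrix (R × A) (R × A) ℂ}
    (h : ρ.PosSemidef) (h1 : ρ.trace = 1) : (1 / 2) * mutualInfo ρ ∈ values ρ ⊤ := by
  -- `values` admits only `Fin` output spaces, so `A` plus vacuum is relabelled.
  have e := Fintype.equivFin (A ⊕ Unit)
  refine ⟨_, _, splitIsometry e, ⟨splitIsometry_isometry e, le_top, ?_⟩, ?_⟩
  · rw [trSecond_output_splitIsometry]
  · rw [mutualInfo_trThird_output_splitIsometry h h1]

lemma trace_output {B E : Type*} [Fintype B] [Fintype E] (ρ : Matrix (R × A) (R × A) ℂ)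
    {V : Matrix (B × E) A ℂ} (hV : Vᴴ * V = 1) : (output ρ V).trace = ρ.trace := by
  rw [output, Matrix.trace_mul_comm, ← Matrix.mul_assoc, Matrix.conjTranspose_kronecker,
    ← Matrix.mul_kronecker_mul, hV, Matrix.conjTranspose_one, one_mul, Matrix.one_kronecker_one,
    one_mul]

lemma trace_trThird {X Y Z : Type*} [Fintype X] [Fintype Y] [Fintype Z]
    (σ : Matrix (X × Y × Z) (X × Y × Z) ℂ) : (trThird σ).trace = σ.trace := by
  simp [Matrix.trace, trThird, Fintype.sum_prod_type]

lemma trace_trSecond {X Y Z : Type*} [Fintype X] [Fintype Y] [Fintype Z]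
    (σ : Matrix (X × Y × Z) (X × Y × Z) ℂ) : (trSecond σ).trace = σ.trace := by
  simp only [Matrix.trace, trSecond, Fintype.sum_prod_type, Matrix.diag_apply, Matrix.of_apply]
  exact Finset.sum_congr rfl fun x _ => Finset.sum_comm

lemma values_bddBelow {ρ : Matrix (R × A) (R × A) ℂ} (h : ρ.PosSemidef) (h1 : ρ.trace = 1)
    (ε : EReal) : BddBelow (values ρ ε) := by
  refine ⟨0, ?_⟩
  rintro _ ⟨dB, dE, V, hV, rfl⟩
  exact mutualInfo_nonneg (posSemidef_trThird (posSemidef_output h V))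
    (by rw [trace_trThird, trace_output ρ hV.1, h1])

/-- In ℝ, `IsGLB` forces the set to be nonempty and bounded below, excluding the default value 0 of
`sInf`. -/
lemma isGLB_values_Xi {ρ : Matrix (R × A) (R × A) ℂ} (h : ρ.PosSemidef) (h1 : ρ.trace = 1) :
    IsGLB (values ρ ⊤) (Xi ρ) :=
  isGLB_csInf ⟨_, half_mutualInfo_mem_values h h1⟩ (values_bddBelow h h1 ⊤)

lemma Xi_le_half_mutualInfo {ρ : Matrix (R × A) (R × A) ℂ} (h : ρ.PosSemidef)
    (h1 : ρ.trace = 1) : Xi ρ ≤ (1 / 2) * mutualInfo ρ :=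
  (isGLB_values_Xi h h1).1 (half_mutualInfo_mem_values h h1)

end Ineliminable

end PQD

theorem mainTheorem3 {R A B : Type*} [Fintype R] [DecidableEq R] [Fintype A] [DecidableEq A]
    [Fintype B] [DecidableEq B] (Ψ : EuclideanSpace ℂ (R × A × B)) (hΨ : ‖Ψ‖ = 1) :
    IsGLB (PQD.values (PQD.trThird (PQD.ketbra Ψ)) ⊤) (PQD.Xi (PQD.trThird (PQD.ketbra Ψ))) ∧
    IsGLB (PQD.values (PQD.trSecond (PQD.ketbra Ψ)) ⊤) (PQD.Xi (PQD.trSecond (PQD.ketbra Ψ))) ∧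
    PQD.Xi (PQD.trThird (PQD.ketbra Ψ)) + PQD.Xi (PQD.trSecond (PQD.ketbra Ψ)) ≤
      PQD.entropy (PQD.trRight (PQD.ketbra Ψ)) := by
  have hp := PQD.posSemidef_ketbra Ψ
  have ht := PQD.trace_ketbra Ψ hΨ
  have hA := PQD.posSemidef_trThird hp
  have hB := PQD.posSemidef_trSecond hp
  have tA : (PQD.trThird (PQD.ketbra Ψ)).trace = 1 := by rw [PQD.trace_trThird, ht]
  have tB : (PQD.trSecond (PQD.ketbra Ψ)).trace = 1 := by rw [PQD.trace_trSecond, ht]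
  refine ⟨PQD.isGLB_values_Xi hA tA, PQD.isGLB_values_Xi hB tB, ?_⟩
  linarith [PQD.Xi_le_half_mutualInfo hA tA, PQD.Xi_le_half_mutualInfo hB tB,
    PQD.mutualInfo_add_mutualInfo_ketbra Ψ]
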